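/- Let $n\ge 1$, let $k$ be a commutative artinian ring, let $J$ be a minimal injective cogenerator of $k$ and $D=\operatorname{Hom}_k(-,J)$. Let $(\mathcal C,\mathbb E,\mathfrak s)$ be a $k$-linear $n$-exangulated category (in the sense of Herschend--Liu--Nakaoka, with $\mathbb E$ a $k$-bilinear bifunctor to $k$-modules) which is Krull--Schmidt and $\operatorname{Ext}$-finite (each $\mathbb E(A,B)$ is a finitely generated $k$-module), and in which: if $g\circ f$ is a deflation then so is $g$, and if $g\circ f$ is an inflation then so is $f$. A morphism $f:A\to B$ is called $n$-projectively (resp. $n$-injectively) trivial if $\mathbb E(f,Z)=0$ (resp. $\mathbb E(Z,f)=0$) for all $Z\in\mathcal C$, and $P\in\mathcal C$ is projective if $\mathrm{id}_P$ is $n$-projectively trivial. Let $\underline{\mathcal C}$ (resp. $\overline{\mathcal C}$) be the quotient of $\mathcal C$ by the ideal of $n$-projectively (resp. $n$-injectively) trivial morphisms. Assume that $\mathcal C$ has Auslander--Reiten--Serre duality: there are a $k$-linear equivalence $\tau_n:\underline{\mathcal C}\to\overline{\mathcal C}$ and $k$-linear isomorphisms $D\mathbb E(A,B)\cong\overline{\mathcal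 C}(B,\tau_nA)$, natural in $A,B\in\mathcal C$. Let $\tau_n^-$ be a quasi-inverse of $\tau_n$. A morphism $f:A\to Y$ is right $C$-determined if every $g:L\to Y$ such that $g\circ h$ factors through $f$ for all $h:C\to L$ factors itself through $f$. Two morphisms $f,f'$ ending at $Y$ are right equivalent if each factors through the other; $[f\rangle$ denotes the right equivalence class of $f$. We write $\operatorname{add}C$ for the class of direct summands of finite direct sums of copies of $C$, and $\operatorname{rad}_{\mathcal C}$ for the Jacobson radical of $\mathcal C$. Let $X,Y\in\mathcal C$, and let $T\in\mathcal C$ be an object representing $\tau_n^-X$, that is, $T\cong\tau_n^-X$ in $\underline{\mathcal C}$. Then, for every distinguished $n$-exangle $$X\xrightarrow{\alpha}X_1\to\cdots\to X_{n-1}\to Z\xrightarrow{\beta}Y\overset{\delta}{\dashrightarrow}$$ the following hold. (1) $\beta$ is right $T$-determined. (2) If $\alpha$ lies in $\operatorname{rad}_{\mathcal C}$ and $T$ is chosen without nonzero projective direct summands, then for every $C\in\mathcal C$: $\beta$ is right $C$-determined if and only if $T\in\operatorname{add}C$. Consequently, ${}_X[\to Y\rangle_{\rm def}={}^{T}[\to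 Y\rangle_{\rm def}$. Here ${}_X[\to Y\rangle_{\rm def}$ is the set of right equivalence classes having a representative $f$ that is the last morphism of a distinguished $n$-exangle $X_0\to X_1\to\cdots\to W\xrightarrow{f}Y\dashrightarrow$ with $X_0\in\operatorname{add}X$, and ${}^{T}[\to Y\rangle_{\rm def}$ is the set of right equivalence classes $[f\rangle$ of deflations $f$ ending at $Y$ that are right $T$-determined. -/

import Mathlib

open CategoryTheory CategoryTheory.Limits Opposite

namespace NExang

universe uk w v u

attribute [local instance] hasBinaryBiproducts_of_finite_biproducts

section Biadditive

variable (k : Type uk) [CommRing k] (C : Type u) [Category.{v} C] [Preadditive C] [Linear k C]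

/-- A `k`-bilinear bifunctor `Cᵒᵖ × C → Mod k`, written `(Z, A) ↦ E(Z, A)`. -/
structure LinearBifunctor where
  functor : Cᵒᵖ ⥤ C ⥤ ModuleCat.{w} k
  push_add : ∀ {Z A B : C} (a a' : A ⟶ B),
    (functor.obj (op Z)).map (a + a') =
      (functor.obj (op Z)).map a + (functor.obj (op Z)).map a'
  push_smul : ∀ {Z A B : C} (r : k) (a : A ⟶ B),
    (functor.obj (op Z)).map (r • a) = r • (functor.obj (op Z)).map a
  pull_add : ∀ {Z W A : C} (c c' : W ⟶ Z),
    (functor.map (c + c').op).app A = (functor.map c.op).app A + (functor.map c'.op).app A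
  pull_smul : ∀ {Z W A : C} (r : k) (c : W ⟶ Z),
    (functor.map (r • c).op).app A = r • (functor.map c.op).app A

variable {k C}

namespace LinearBifunctor

variable (E : LinearBifunctor.{uk, w, v, u} k C)

/-- The module `E(Z, A)` of extensions of `Z` by `A`. -/
abbrev Ext (Z A : C) : Type w := (E.functor.obj (op Z)).obj A

/-- `a_* : E(Z, A) → E(Z, B)` for `a : A ⟶ B`. -/
def push {Z A B : C} (a : A ⟶ B) : E.Ext Z A →ₗ[k] E.Ext Z B :=
  ((E.functor.obj (op Z)).map a).hom

/-- `c^* : E(Z, A) → E(W, A)` for `c : W ⟶ Z`. -/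
def pull {Z W A : C} (c : W ⟶ Z) : E.Ext Z A →ₗ[k] E.Ext W A :=
  ((E.functor.map c.op).app A).hom

end LinearBifunctor

end Biadditive

section Complexes

variable {C : Type u} [Category.{v} C] [Preadditive C]

/-- A complex `A = X_0 ⟶ X_1 ⟶ ⋯ ⟶ X_n ⟶ X_{n+1} = Z` concentrated in degrees `0, …, n + 1`, with
prescribed end terms: the equalities `X_0 = A` and `X_{n+1} = Z` are expressed by identifications
`left` and `right`. -/
structure NComplex (n : ℕ) (A Z : C) where
  cx : CochainComplex C ℕ
  isZero : ∀ i, n + 1 < i → IsZero (cx.X i)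
  left : cx.X 0 ≅ A
  right : cx.X (n + 1) ≅ Z

namespace NComplex

variable {n : ℕ}

/-- The first differential `A ⟶ X_1`. -/
def first {A Z : C} (X : NComplex n A Z) : A ⟶ X.cx.X 1 := X.left.inv ≫ X.cx.d 0 1

/-- The last differential `X_n ⟶ Z`. -/
def last {A Z : C} (X : NComplex n A Z) : X.cx.X n ⟶ Z := X.cx.d n (n + 1) ≫ X.right.hom

/-- `f : X ⟶ Y` has the component `a` in degree `0` and the component `c` in degree `n + 1`. -/
def HasEnds {A Z A' Z' : C} (X : NComplex n A Z) (Y : NComplex n A' Z') (f : X.cx ⟶ Y.cx)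
    (a : A ⟶ A') (c : Z ⟶ Z') : Prop :=
  f.f 0 ≫ Y.left.hom = X.left.hom ≫ a ∧ f.f (n + 1) ≫ Y.right.hom = X.right.hom ≫ c

/-- Homotopy equivalence in the category of complexes with fixed end terms `A` and `Z`, whose
morphisms are the identity in degrees `0` and `n + 1`. -/
def HtpyEquiv {A Z : C} (X Y : NComplex n A Z) : Prop :=
  ∃ (f : X.cx ⟶ Y.cx) (g : Y.cx ⟶ X.cx),
    HasEnds X Y f (𝟙 A) (𝟙 Z) ∧ HasEnds Y X g (𝟙 A) (𝟙 Z) ∧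
    Nonempty (Homotopy (f ≫ g) (𝟙 X.cx)) ∧ Nonempty (Homotopy (g ≫ f) (𝟙 Y.cx))

variable [HasFiniteBiproducts C]

/-- For `f : X ⟶ Y` which is the identity in degree `0`, the complex `M` is (isomorphic, relative
to the end terms, to) the mapping cone of `f`,
`X_1 ⟶ X_2 ⊞ Y_1 ⟶ ⋯ ⟶ X_{n+1} ⊞ Y_n ⟶ Y_{n+1}`,
with differentials `[-d; f]`, `[-d 0; f d]` and `[f d]`. -/
def IsMappingCone {A Z Z' : C} (X : NComplex n A Z) (Y : NComplex n A Z') (f : X.cx ⟶ Y.cx)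
    (M : NComplex n (X.cx.X 1) Z') : Prop :=
  ∃ φ : ∀ i, M.cx.X i ⟶ X.cx.X (i + 1) ⊞ Y.cx.X i,
    (∀ i, 1 ≤ i → i ≤ n → IsIso (φ i)) ∧
    M.first ≫ φ 1 = biprod.lift (-X.cx.d 1 2) (f.f 1) ∧
    (∀ i, 1 ≤ i → i + 1 ≤ n →
      M.cx.d i (i + 1) ≫ φ (i + 1) =
        φ i ≫ biprod.desc (biprod.lift (-X.cx.d (i + 1) (i + 2)) (f.f (i + 1)))
          (biprod.lift 0 (Y.cx.d i (i + 1)))) ∧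
    M.last = φ n ≫ biprod.desc (f.f (n + 1) ≫ Y.right.hom) Y.last

/-- For `h : X ⟶ Y` which is the identity in degree `n + 1`, the complex `M` is (isomorphic,
relative to the end terms, to) the mapping cocone of `h`, the formal dual of the mapping cone,
`X_0 ⟶ X_1 ⊞ Y_0 ⟶ ⋯ ⟶ X_n ⊞ Y_{n-1} ⟶ Y_n`,
with differentials `[d; h]`, `[d 0; h -d]` and `[h -d]`. -/
def IsMappingCocone {A A' Z : C} (X : NComplex n A Z) (Y : NComplex n A' Z) (h : X.cx ⟶ Y.cx)
    (M : NComplex n A (Y.cx.X n)) : Prop :=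
  ∃ φ : ∀ i j, M.cx.X i ⟶ X.cx.X i ⊞ Y.cx.X j,
    (∀ i j, j + 1 = i → i ≤ n → IsIso (φ i j)) ∧
    M.first ≫ φ 1 0 = biprod.lift X.first (X.left.inv ≫ h.f 0) ∧
    (∀ i j, j + 1 = i → i + 1 ≤ n →
      M.cx.d i (i + 1) ≫ φ (i + 1) i =
        φ i j ≫ biprod.desc (biprod.lift (X.cx.d i (i + 1)) (h.f i))
          (biprod.lift 0 (-Y.cx.d j i))) ∧
    (∀ j, j + 1 = n → M.last = φ n j ≫ biprod.desc (h.f n) (-Y.cx.d j n))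

end NComplex

end Complexes

section Exangulated

variable (k : Type uk) [CommRing k] (C : Type u) [Category.{v} C] [Preadditive C] [Linear k C]

/-- `⟨X, δ⟩` is an `n`-exangle: `d_0` kills `δ` covariantly, `d_n` kills `δ` contravariantly, and
the sequences `C(-, X_0) → ⋯ → C(-, X_{n+1}) → E(-, X_0)` and
`C(X_{n+1}, -) → ⋯ → C(X_0, -) → E(X_{n+1}, -)` are exact. -/
structure IsNExangle {k : Type uk} [CommRing k] {C : Type u} [Category.{v} C] [Preadditive C]
    [Linear k C] (E : LinearBifunctor.{uk, w, v, u} k C) {n : ℕ} {A Z : C} (X : NComplex n A Z)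
    (δ : E.Ext Z A) : Prop where
  push_first : E.push X.first δ = 0
  pull_last : E.pull X.last δ = 0
  exact_hom_to : ∀ i, i + 1 ≤ n → ∀ {T : C} (g : T ⟶ X.cx.X (i + 1)),
    g ≫ X.cx.d (i + 1) (i + 2) = 0 → ∃ h : T ⟶ X.cx.X i, h ≫ X.cx.d i (i + 1) = g
  exact_hom_to_right : ∀ {T : C} (g : T ⟶ Z), E.pull g δ = 0 →
    ∃ h : T ⟶ X.cx.X n, h ≫ X.last = g
  exact_hom_from : ∀ i, i + 1 ≤ n → ∀ {T : C} (g : X.cx.X (i + 1) ⟶ T),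
    X.cx.d i (i + 1) ≫ g = 0 → ∃ h : X.cx.X (i + 2) ⟶ T, X.cx.d (i + 1) (i + 2) ≫ h = g
  exact_hom_from_left : ∀ {T : C} (g : A ⟶ T), E.push g δ = 0 →
    ∃ h : X.cx.X 1 ⟶ T, X.first ≫ h = g

/-- A correspondence `s` assigning to every extension `δ ∈ E(Z, A)` a set of complexes from `A` to
`Z`; the complexes in `s δ` are those realizing `δ`. -/
abbrev Correspondence {k : Type uk} [CommRing k] {C : Type u} [Category.{v} C] [Preadditive C]
    [Linear k C] (E : LinearBifunctor.{uk, w, v, u} k C) (n : ℕ) :=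
  ∀ {Z A : C}, E.Ext Z A → Set (NComplex n A Z)

section Flations

variable {k C} {E : LinearBifunctor.{uk, w, v, u} k C} {n : ℕ}

/-- `f` is the first morphism of a conflation. -/
def IsInflation (s : Correspondence E n) {A B : C} (f : A ⟶ B) : Prop :=
  ∃ (Z : C) (δ : E.Ext Z A) (X : NComplex n A Z) (φ : X.cx.X 1 ≅ B),
    X ∈ s δ ∧ X.first ≫ φ.hom = f

/-- `g` is the last morphism of a conflation. -/
def IsDeflation (s : Correspondence E n) {B Z : C} (g : B ⟶ Z) : Prop :=
  ∃ (A : C) (δ : E.Ext Z A) (X : NComplex n A Z) (φ : B ≅ X.cx.X n),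
    X ∈ s δ ∧ φ.hom ≫ X.last = g

end Flations

/-- A `k`-linear `n`-exangulated category structure on the additive `k`-linear category `C`. -/
structure NExangulated [HasFiniteBiproducts C] (n : ℕ) where
  E : LinearBifunctor.{uk, w, v, u} k C
  s : Correspondence E n
  /- every extension is sent to a homotopy equivalence class -/
  nonempty : ∀ {Z A : C} (δ : E.Ext Z A), (s δ).Nonempty
  mem_iff : ∀ {Z A : C} (δ : E.Ext Z A) (X Y : NComplex n A Z), X ∈ s δ →
    (Y ∈ s δ ↔ NComplex.HtpyEquiv X Y)
  /- (R0): morphisms of extensions lift to morphisms of complexes -/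
  lift : ∀ {Z A Z' A' : C} (δ : E.Ext Z A) (ρ : E.Ext Z' A') (X : NComplex n A Z)
    (Y : NComplex n A' Z'), X ∈ s δ → Y ∈ s ρ → ∀ (a : A ⟶ A') (c : Z ⟶ Z'),
    E.push a δ = E.pull c ρ → ∃ f : X.cx ⟶ Y.cx, NComplex.HasEnds X Y f a c
  /- (R1): realizations are `n`-exangles -/
  isNExangle : ∀ {Z A : C} (δ : E.Ext Z A) (X : NComplex n A Z), X ∈ s δ → IsNExangle E X δ
  /- (R2): `0 ∈ E(0, A)` is realized by `A = A ⟶ 0 ⟶ ⋯ ⟶ 0` -/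
  zero_left : ∀ {O A : C}, IsZero O → ∀ X : NComplex n A O, IsIso (X.cx.d 0 1) →
    (∀ i, 2 ≤ i → IsZero (X.cx.X i)) → X ∈ s (0 : E.Ext O A)
  /- (R2), dual: `0 ∈ E(A, 0)` is realized by `0 ⟶ ⋯ ⟶ 0 ⟶ A = A` -/
  zero_right : ∀ {O A : C}, IsZero O → ∀ X : NComplex n O A, IsIso (X.cx.d n (n + 1)) →
    (∀ i, i < n → IsZero (X.cx.X i)) → X ∈ s (0 : E.Ext A O)
  /- (EA1): inflations and deflations are closed under composition -/
  inflation_comp : ∀ {A B D : C} (f : A ⟶ B) (g : B ⟶ D),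
    IsInflation s f → IsInflation s g → IsInflation s (f ≫ g)
  deflation_comp : ∀ {A B D : C} (f : A ⟶ B) (g : B ⟶ D),
    IsDeflation s f → IsDeflation s g → IsDeflation s (f ≫ g)
  /- (EA2): `(𝟙, c)` has a good lift, whose mapping cone realizes `(d_0)_* ρ` -/
  good_lift : ∀ {A B D : C} (ρ : E.Ext D A) (c : B ⟶ D) (X : NComplex n A B)
    (Y : NComplex n A D), X ∈ s (E.pull c ρ) → Y ∈ s ρ →
    ∃ f : X.cx ⟶ Y.cx, NComplex.HasEnds X Y f (𝟙 A) c ∧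
      ∃ M ∈ s (E.push X.first ρ), NComplex.IsMappingCone X Y f M
  /- (EA2ᵒᵖ): `(a, 𝟙)` has a good lift, whose mapping cocone realizes `(d_n)^* δ` -/
  good_lift_op : ∀ {A B D : C} (δ : E.Ext D A) (a : A ⟶ B) (X : NComplex n A D)
    (Y : NComplex n B D), X ∈ s δ → Y ∈ s (E.push a δ) →
    ∃ h : X.cx ⟶ Y.cx, NComplex.HasEnds X Y h a (𝟙 D) ∧
      ∃ M ∈ s (E.pull Y.last δ), NComplex.IsMappingCocone X Y h M

end Exangulated

section Additive

variable {C : Type u} [Category.{v} C] [Preadditive C]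

/-- The Jacobson radical of `C`. -/
def InRadical {A B : C} (f : A ⟶ B) : Prop := ∀ g : B ⟶ A, IsIso (𝟙 A - f ≫ g)

/-- Every object is a finite direct sum of objects with local endomorphism rings. -/
def KrullSchmidt (C : Type u) [Category.{v} C] [Preadditive C] [HasFiniteBiproducts C] : Prop :=
  ∀ X : C, ∃ (m : ℕ) (Y : Fin m → C), (∀ i, IsLocalRing (End (Y i))) ∧ Nonempty (X ≅ ⨁ Y)

/-- `T ∈ add B`: `T` is a direct summand of a finite direct sum of copies of `B`. -/
def InAdd [HasFiniteBiproducts C] (B T : C) : Prop :=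
  ∃ m : ℕ, Nonempty (Retract T (⨁ fun _ : Fin m => B))

/-- `f` is right `B`-determined. -/
def RightDetermined (B : C) {X Y : C} (f : X ⟶ Y) : Prop :=
  ∀ {L : C} (g : L ⟶ Y), (∀ h : B ⟶ L, ∃ t : B ⟶ X, t ≫ f = h ≫ g) → ∃ t : L ⟶ X, t ≫ f = g

/-- Right equivalence of morphisms ending at `Y`: each factors through the other. -/
def rightEquiv (Y : C) : Setoid (Over Y) where
  r f g := (∃ t : f.left ⟶ g.left, t ≫ g.hom = f.hom) ∧ ∃ t : g.left ⟶ f.left, t ≫ f.hom = g.hom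
  iseqv :=
    { refl := fun f => ⟨⟨𝟙 _, by simp⟩, ⟨𝟙 _, by simp⟩⟩
      symm := fun h => ⟨h.2, h.1⟩
      trans := by
        rintro f g h ⟨⟨a, ha⟩, ⟨b, hb⟩⟩ ⟨⟨c, hc⟩, ⟨d, hd⟩⟩
        exact ⟨⟨a ≫ c, by rw [Category.assoc, hc, ha]⟩, ⟨d ≫ b, by rw [Category.assoc, hb, hd]⟩⟩ }

/-- The collection `[→ Y⟩` of right equivalence classes of morphisms ending at `Y`. -/
abbrev RightClass (Y : C) := Quotient (rightEquiv Y)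

/-- The right equivalence class `[f⟩`. -/
def rightClass {X Y : C} (f : X ⟶ Y) : RightClass Y := Quotient.mk (rightEquiv Y) (Over.mk f)

/-- The classes of right `B`-determined morphisms ending at `Y`. -/
def determinedClasses (B Y : C) : Set (RightClass Y) :=
  {c | ∃ (X : C) (f : X ⟶ Y), RightDetermined B f ∧ rightClass f = c}

end Additive

namespace NExangulated

variable {k : Type uk} [CommRing k] {C : Type u} [Category.{v} C] [Preadditive C] [Linear k C]
  [HasFiniteBiproducts C] {n : ℕ} (S : NExangulated.{uk, w, v, u} k C n)

/-- `Ext`-finiteness. -/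
def ExtFinite : Prop := ∀ A B : C, Module.Finite k (S.E.Ext A B)

/-- If `f ≫ g` is a deflation so is `g`, and if `f ≫ g` is an inflation so is `f`. -/
def WICondition : Prop :=
  ∀ {A B D : C} (f : A ⟶ B) (g : B ⟶ D),
    (IsDeflation S.s (f ≫ g) → IsDeflation S.s g) ∧ (IsInflation S.s (f ≫ g) → IsInflation S.s f)

/-- The set `[→ Y⟩_def` of right equivalence classes of deflations ending at `Y`. -/
def deflationClasses (Y : C) : Set (RightClass Y) :=
  {c | ∃ (B : C) (f : B ⟶ Y), IsDeflation S.s f ∧ rightClass f = c}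

/-- The set `_X[→ Y⟩_def` of classes with a representative that is the last morphism of a
distinguished `n`-exangle whose first term lies in `add X`. -/
def kernelEndClasses (X Y : C) : Set (RightClass Y) :=
  {c | ∃ (X₀ : C) (δ : S.E.Ext Y X₀) (W : NComplex n X₀ Y),
    W ∈ S.s δ ∧ InAdd X X₀ ∧ rightClass W.last = c}

/-- `f` is `n`-projectively trivial: `E(f, Z) = 0` for all `Z`. -/
def ProjTrivial {A B : C} (f : A ⟶ B) : Prop :=
  ∀ (Z : C) (δ : S.E.Ext B Z), S.E.pull f δ = 0

/-- `f` is `n`-injectively trivial: `E(Z, f) = 0` for all `Z`. -/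
def InjTrivial {A B : C} (f : A ⟶ B) : Prop :=
  ∀ (Z : C) (δ : S.E.Ext Z A), S.E.push f δ = 0

def IsProjective (P : C) : Prop := S.ProjTrivial (𝟙 P)

/-- `T` has no nonzero projective direct summand. -/
def NoProjectiveSummand (T : C) : Prop :=
  ∀ P : C, Nonempty (Retract P T) → S.IsProjective P → IsZero P

section Ideals

variable {Z W V A B D : C}

lemma pull_add (c c' : W ⟶ Z) (δ : S.E.Ext Z A) :
    S.E.pull (c + c') δ = S.E.pull c δ + S.E.pull c' δ := by
  rw [LinearBifunctor.pull, S.E.pull_add]; rfl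

lemma pull_smul (r : k) (c : W ⟶ Z) (δ : S.E.Ext Z A) :
    S.E.pull (r • c) δ = r • S.E.pull c δ := by
  rw [LinearBifunctor.pull, S.E.pull_smul]; rfl

lemma pull_comp (b : V ⟶ W) (c : W ⟶ Z) (δ : S.E.Ext Z A) :
    S.E.pull (b ≫ c) δ = S.E.pull b (S.E.pull c δ) := by
  simp [LinearBifunctor.pull]

lemma push_add (a a' : A ⟶ B) (δ : S.E.Ext Z A) :
    S.E.push (a + a') δ = S.E.push a δ + S.E.push a' δ := by
  simp [LinearBifunctor.push, S.E.push_add]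

lemma push_smul (r : k) (a : A ⟶ B) (δ : S.E.Ext Z A) :
    S.E.push (r • a) δ = r • S.E.push a δ := by
  simp [LinearBifunctor.push, S.E.push_smul]

lemma push_comp (a : A ⟶ B) (b : B ⟶ D) (δ : S.E.Ext Z A) :
    S.E.push (a ≫ b) δ = S.E.push b (S.E.push a δ) := by
  simp [LinearBifunctor.push]

lemma ProjTrivial.zero : S.ProjTrivial (0 : A ⟶ B) := fun Z δ => by
  simpa using S.pull_smul (0 : k) (0 : A ⟶ B) δ

lemma ProjTrivial.add {f g : A ⟶ B} (hf : S.ProjTrivial f) (hg : S.ProjTrivial g) :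
    S.ProjTrivial (f + g) := fun Z δ => by rw [pull_add, hf, hg, add_zero]

lemma ProjTrivial.smul (r : k) {f : A ⟶ B} (hf : S.ProjTrivial f) :
    S.ProjTrivial (r • f) := fun Z δ => by rw [pull_smul, hf, smul_zero]

lemma InjTrivial.zero : S.InjTrivial (0 : A ⟶ B) := fun Z δ => by
  simpa using S.push_smul (0 : k) (0 : A ⟶ B) δ

lemma InjTrivial.add {f g : A ⟶ B} (hf : S.InjTrivial f) (hg : S.InjTrivial g) :
    S.InjTrivial (f + g) := fun Z δ => by rw [push_add, hf, hg, add_zero]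

lemma InjTrivial.smul (r : k) {f : A ⟶ B} (hf : S.InjTrivial f) :
    S.InjTrivial (r • f) := fun Z δ => by rw [push_smul, hf, smul_zero]

end Ideals

/-- Congruence modulo `n`-projectively trivial morphisms. -/
def projRel : HomRel C := fun _ _ f g => S.ProjTrivial (f - g)

/-- Congruence modulo `n`-injectively trivial morphisms. -/
def injRel : HomRel C := fun _ _ f g => S.InjTrivial (f - g)

instance : Congruence S.projRel where
  equivalence :=
    { refl := fun f => by simpa [projRel] using ProjTrivial.zero S
      symm := fun {f g} h => by
        have := ProjTrivial.smul S (-1 : k) h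
        simpa [projRel] using this
      trans := fun {f g l} h h' => by
        have := ProjTrivial.add S h h'
        simpa [projRel] using this }
  comp_left := fun {_ _ _} f {g g'} h Z δ => by
    rw [← Preadditive.comp_sub, pull_comp, h, map_zero]
  comp_right := fun {_ _ _ f f'} g h Z δ => by
    rw [← Preadditive.sub_comp, pull_comp, h]

instance : Congruence S.injRel where
  equivalence :=
    { refl := fun f => by simpa [injRel] using InjTrivial.zero S
      symm := fun {f g} h => by
        have := InjTrivial.smul S (-1 : k) h
        simpa [injRel] using this
      trans := fun {f g l} h h' => by
        have := InjTrivial.add S h h'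
        simpa [injRel] using this }
  comp_left := fun {_ _ _} f {g g'} h Z δ => by
    rw [← Preadditive.comp_sub, push_comp, h]
  comp_right := fun {_ _ _ f f'} g h Z δ => by
    rw [← Preadditive.sub_comp, push_comp, h, map_zero]

lemma projRel_add ⦃X Y : C⦄ (f₁ f₂ g₁ g₂ : X ⟶ Y) (hf : S.projRel f₁ f₂) (hg : S.projRel g₁ g₂) :
    S.projRel (f₁ + g₁) (f₂ + g₂) := by
  have := ProjTrivial.add S hf hg
  rwa [sub_add_sub_comm] at this

lemma projRel_smul (r : k) ⦃X Y : C⦄ (f₁ f₂ : X ⟶ Y) (hf : S.projRel f₁ f₂) :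
    S.projRel (r • f₁) (r • f₂) := by
  have := ProjTrivial.smul S r hf
  rwa [smul_sub] at this

lemma injRel_add ⦃X Y : C⦄ (f₁ f₂ g₁ g₂ : X ⟶ Y) (hf : S.injRel f₁ f₂) (hg : S.injRel g₁ g₂) :
    S.injRel (f₁ + g₁) (f₂ + g₂) := by
  have := InjTrivial.add S hf hg
  rwa [sub_add_sub_comm] at this

lemma injRel_smul (r : k) ⦃X Y : C⦄ (f₁ f₂ : X ⟶ Y) (hf : S.injRel f₁ f₂) :
    S.injRel (r • f₁) (r • f₂) := by
  have := InjTrivial.smul S r hf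
  rwa [smul_sub] at this

/-- The stable category: `C` modulo `n`-projectively trivial morphisms. -/
abbrev Stable := CategoryTheory.Quotient S.projRel

/-- The costable category: `C` modulo `n`-injectively trivial morphisms. -/
abbrev Costable := CategoryTheory.Quotient S.injRel

/-- The projection from `C` to the stable category. -/
abbrev toStable : C ⥤ S.Stable := CategoryTheory.Quotient.functor S.projRel

/-- The projection from `C` to the costable category. -/
abbrev toCostable : C ⥤ S.Costable := CategoryTheory.Quotient.functor S.injRel

instance : Preadditive S.Stable := CategoryTheory.Quotient.preadditive _ S.projRel_add

instance : S.toStable.Additive := CategoryTheory.Quotient.functor_additive _ S.projRel_add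

instance : Linear k S.Stable := CategoryTheory.Quotient.linear k _ S.projRel_smul

instance : Preadditive S.Costable := CategoryTheory.Quotient.preadditive _ S.injRel_add

instance : S.toCostable.Additive := CategoryTheory.Quotient.functor_additive _ S.injRel_add

instance : Linear k S.Costable := CategoryTheory.Quotient.linear k _ S.injRel_smul

/-- Auslander-Reiten-Serre duality, with `D = Hom_k(-, J)`: a `k`-linear equivalence `τ` from the
stable to the costable category and `k`-linear isomorphisms
`D E(X, Y) ≃ Costable(Y, τ X)` natural in `X` and `Y`. -/
structure ARSDuality (J : Type uk) [AddCommGroup J] [Module k J] where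
  τ : S.Stable ≌ S.Costable
  additive : τ.functor.Additive
  linear : τ.functor.Linear k
  Φ : ∀ X Y : C, (S.E.Ext X Y →ₗ[k] J) ≃ₗ[k]
    (S.toCostable.obj Y ⟶ τ.functor.obj (S.toStable.obj X))
  naturality : ∀ {X X' Y Y' : C} (x : X ⟶ X') (y : Y' ⟶ Y) (φ : S.E.Ext X Y →ₗ[k] J),
    Φ X' Y' (φ ∘ₗ S.E.pull x ∘ₗ S.E.push y) =
      S.toCostable.map y ≫ Φ X Y φ ≫ τ.functor.map (S.toStable.map x)

/-- The object `T` of `C` represents `τ⁻ X`, where `τ⁻` is the quasi-inverse of `τ`. As `τ⁻ X` is an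
object of the stable category, it determines `T` up to isomorphism in the stable category only. -/
def ARSDuality.IsInverseTranslate {S : NExangulated.{uk, w, v, u} k C n} {J : Type uk}
    [AddCommGroup J] [Module k J] (D : S.ARSDuality J) (X T : C) : Prop :=
  Nonempty (S.toStable.obj T ≅ D.τ.inverse.obj (S.toCostable.obj X))

end NExangulated

section Cogenerator

variable (k : Type uk) [CommRing k]

/-- `J` is an injective cogenerator of the category of `k`-modules. -/
def IsInjectiveCogenerator (J : Type uk) [AddCommGroup J] [Module k J] : Prop :=
  Module.Injective k J ∧
    ∀ (M : Type uk) [AddCommGroup M] [Module k M] (x : M), x ≠ 0 → ∃ f : M →ₗ[k] J, f x ≠ 0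

/-- `J` is a minimal injective cogenerator: no proper submodule is an injective cogenerator. -/
def IsMinimalInjectiveCogenerator (J : Type uk) [AddCommGroup J] [Module k J] : Prop :=
  IsInjectiveCogenerator k J ∧ ∀ N : Submodule k J, IsInjectiveCogenerator k N → N = ⊤

end Cogenerator

end NExang

/-! A morphism `g` factors through the last morphism of a conflation realizing `δ` exactly when the
pullback `g^*δ` vanishes, so determination is a question about vanishing of extensions. Duality
answers it. Fix an isomorphism `e : X ≅ τT` in the costable category and let `θ` be the functional
on `E(T, X)` that corresponds to it. Since `τ` and both projections are full, every functional on
`E(L, X)` is `θ ∘ h^*` with `h : T ⟶ L`, and every functional on `E(T, A)` is `θ ∘ a_*` with `a : A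
⟶ X` (`eq_zero_of_pull`, `eq_zero_of_push`). As `J` separates points, the first fact gives
`T`-determination; both enter the equality of classes.

For minimality, let `T'` be a local non-projective summand of `T`, and let `B` determine `β`. The
maps `α_*` on `E(T', X)` and `h^*` for `h : B ⟶ T'` are jointly injective. By finite length, each
functional is a finite sum of functionals factoring through them. Translated by `Φ`, the projection
`T ⟶ T'` is, up to a term through `α`, a sum of maps through `B`. If `T'` were not a summand of `B`,
locality would make `τT'` a costable retract through the radical map `α`, hence zero, and `T'`
projective. -/

namespace NExang

universe uk w w' v u

attribute [local instance] hasBinaryBiproducts_of_finite_biproducts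

/-! ### Functionals with values in an injective cogenerator -/

section Modules

variable {k : Type uk} [CommRing k] {J : Type uk} [AddCommGroup J] [Module k J]

/-- An injective cogenerator separates the points of modules in every universe. -/
lemma IsInjectiveCogenerator.exists_apply_ne_zero (hJ : IsInjectiveCogenerator k J)
    {M : Type w} [AddCommGroup M] [Module k M] {x : M} (hx : x ≠ 0) :
    ∃ f : M →ₗ[k] J, f x ≠ 0 := by
  have := hJ.1
  -- The cyclic module generated by `x` is a quotient of `k`, so it has a copy in the universe where
  -- `J` is assumed to separate points; injectivity then extends the functional to `M`.
  let e := LinearMap.quotKerEquivRange (LinearMap.toSpanSingleton k M x)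
  let y : LinearMap.range (LinearMap.toSpanSingleton k M x) := ⟨x, 1, by simp⟩
  have hy : e.symm y ≠ 0 := by
    simpa [y, Subtype.ext_iff] using hx
  obtain ⟨f, hf⟩ := hJ.2 _ _ hy
  obtain ⟨g, hg⟩ := Module.Injective.extension_property k J _ _
    (Submodule.subtype (LinearMap.range (LinearMap.toSpanSingleton k M x)))
    (Submodule.subtype_injective _) (f ∘ₗ e.symm.toLinearMap)
  refine ⟨g, ?_⟩
  have := LinearMap.congr_fun hg y
  simp only [LinearMap.comp_apply, Submodule.subtype_apply, LinearEquiv.coe_coe] at this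
  change g x = _ at this
  rwa [this]

/-- In an artinian module, a jointly injective family has a finite jointly injective subfamily. -/
lemma exists_finset_jointly_injective {M : Type w} [AddCommGroup M] [Module k M] [IsArtinian k M]
    {ι : Type w'} {N : ι → Type w} [∀ i, AddCommGroup (N i)] [∀ i, Module k (N i)]
    (g : ∀ i, M →ₗ[k] N i) (hg : ∀ m, (∀ i, g i m = 0) → m = 0) :
    ∃ s : Finset ι, ∀ m, (∀ i ∈ s, g i m = 0) → m = 0 := by
  classical
  -- A minimal finite intersection of kernels cannot shrink when one more index is added, so it lies
  -- in every kernel.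
  obtain ⟨K, ⟨s, rfl⟩, hK⟩ := IsArtinian.set_has_minimal
    (Set.range fun s : Finset ι => s.inf fun i => LinearMap.ker (g i)) (Set.range_nonempty _)
  refine ⟨s, fun m hm => hg m fun i => ?_⟩
  have hle : (insert i s).inf (fun i => LinearMap.ker (g i)) ≤
      s.inf fun i => LinearMap.ker (g i) := Finset.inf_mono (Finset.subset_insert i s)
  have heq := eq_of_le_of_not_lt hle (hK _ ⟨insert i s, rfl⟩)
  have hm' : m ∈ s.inf fun i => LinearMap.ker (g i) := by
    simpa [Submodule.mem_finsetInf] using hm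
  rw [← heq, Submodule.mem_finsetInf] at hm'
  exact hm' i (Finset.mem_insert_self i s)

/-- A functional on an artinian module with values in an injective module is a finite sum of
functionals factoring through the members of a given jointly injective family. -/
lemma exists_eq_sum_comp (hJ : Module.Injective k J) {M : Type w} [AddCommGroup M]
    [Module k M] [IsArtinian k M] {ι : Type w'} {N : ι → Type w} [∀ i, AddCommGroup (N i)]
    [∀ i, Module k (N i)] (g : ∀ i, M →ₗ[k] N i) (hg : ∀ m, (∀ i, g i m = 0) → m = 0)
    (φ : M →ₗ[k] J) :
    ∃ (s : Finset ι) (ψ : ∀ i, N i →ₗ[k] J), φ = ∑ i ∈ s, ψ i ∘ₗ g i := by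
  classical
  obtain ⟨s, hs⟩ := exists_finset_jointly_injective g hg
  -- The finite subfamily embeds `M` into a finite product; `φ` extends to that product and splits
  -- there into its components.
  obtain ⟨ψ, hψ⟩ := Module.Injective.extension_property k J _ _
    (LinearMap.pi fun i : s => g i)
    ((injective_iff_map_eq_zero _).2 fun m hm => hs m fun i hi => congrFun hm ⟨i, hi⟩) φ
  refine ⟨s, fun i => if h : i ∈ s then
    ψ ∘ₗ LinearMap.single k (fun i : s => N i) ⟨i, h⟩ else 0, ?_⟩
  ext m
  rw [← hψ, LinearMap.sum_apply, ← Finset.sum_coe_sort s]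
  simp only [LinearMap.comp_apply, Finset.coe_mem, dite_true, ← map_sum]
  congr 1
  exact (LinearMap.sum_single_apply (fun i : s => N i) fun i : s => g i m).symm

end Modules

/-! ### Determined morphisms and direct summands -/

section Additive

variable {C : Type u} [Category.{v} C]

lemma RightDetermined.of_rightEquiv {B X X' Y : C} {f : X ⟶ Y} {f' : X' ⟶ Y}
    (hf : RightDetermined B f) (h : rightClass f = rightClass f') : RightDetermined B f' := by
  obtain ⟨⟨a, ha⟩, b, hb⟩ := Quotient.exact h
  simp only [Over.mk_hom] at ha hb
  intro L g hg
  obtain ⟨t, rfl⟩ := hf g fun l => by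
    obtain ⟨t, ht⟩ := hg l
    exact ⟨t ≫ b, by rw [← ht, Category.assoc]; exact congrArg (t ≫ ·) hb⟩
  exact ⟨t ≫ a, by rw [Category.assoc]; exact congrArg (t ≫ ·) ha⟩

variable [Preadditive C] [HasFiniteBiproducts C]

/-- A map out of `T` extends along the retraction to a sum of copies of `B`, where lifts can be
found componentwise. -/
lemma RightDetermined.of_inAdd {B T X Y : C} {f : X ⟶ Y} (hf : RightDetermined T f)
    (hT : InAdd B T) : RightDetermined B f := by
  classical
  obtain ⟨m, ⟨r⟩⟩ := hT
  intro L g hg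
  refine hf g fun h => ?_
  choose t ht using fun j : Fin m => hg (biproduct.ι (fun _ : Fin m => B) j ≫ r.r ≫ h)
  refine ⟨r.i ≫ biproduct.desc t, ?_⟩
  have : biproduct.desc t ≫ f = r.r ≫ h ≫ g :=
    biproduct.hom_ext' _ _ fun j => by simp [ht]
  rw [Category.assoc, this, r.retract_assoc]

lemma inAdd_biproduct (B : C) (m : ℕ) : InAdd B (⨁ fun _ : Fin m => B) :=
  ⟨m, ⟨Retract.refl _⟩⟩

/-- A finite direct sum of direct summands of `B` lies in `add B`. -/
lemma inAdd_of_retracts {B T : C} {m : ℕ} {Y : Fin m → C} (e : T ≅ ⨁ Y)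
    (h : ∀ i, Nonempty (Retract (Y i) B)) : InAdd B T := by
  let r := fun i => (h i).some
  exact ⟨m, ⟨{
    i := e.hom ≫ biproduct.map fun i => (r i).i
    r := biproduct.map (fun i => (r i).r) ≫ e.inv
    retract := by
      have : biproduct.map (fun i => (r i).i) ≫ biproduct.map (fun i => (r i).r) = 𝟙 (⨁ Y) := by
        refine biproduct.hom_ext _ _ fun j => ?_
        simp
      rw [Category.assoc, reassoc_of% this, e.hom_inv_id] }⟩⟩

end Additive

/-! ### Extensions, conflations and the costable category -/

namespace NExangulated

variable {k : Type uk} [CommRing k] {C : Type u} [Category.{v} C] [Preadditive C] [Linear k C]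
  [HasFiniteBiproducts C] {n : ℕ} (S : NExangulated.{uk, w, v, u} k C n)

lemma pull_id {Z A : C} (δ : S.E.Ext Z A) : S.E.pull (𝟙 Z) δ = δ := by
  simp [LinearBifunctor.pull]

lemma push_id {Z A : C} (δ : S.E.Ext Z A) : S.E.push (𝟙 A) δ = δ := by
  simp [LinearBifunctor.push]

lemma push_pull {Z W A B : C} (c : W ⟶ Z) (a : A ⟶ B) (δ : S.E.Ext Z A) :
    S.E.push a (S.E.pull c δ) = S.E.pull c (S.E.push a δ) := by
  have := (S.E.functor.map c.op).naturality a
  exact (congrArg (fun f => f.hom δ) this).symm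

lemma pull_zero {Z W A : C} (δ : S.E.Ext Z A) : S.E.pull (0 : W ⟶ Z) δ = 0 :=
  ProjTrivial.zero S A δ

lemma push_zero {Z A B : C} (δ : S.E.Ext Z A) : S.E.push (0 : A ⟶ B) δ = 0 :=
  InjTrivial.zero S Z δ

lemma push_sum {Z A B : C} {ι : Type*} (s : Finset ι) (a : ι → (A ⟶ B)) (δ : S.E.Ext Z A) :
    S.E.push (∑ i ∈ s, a i) δ = ∑ i ∈ s, S.E.push (a i) δ := by
  classical
  induction s using Finset.induction_on with
  | empty => simp [push_zero]
  | insert i s hi ih => rw [Finset.sum_insert hi, Finset.sum_insert hi, push_add, ih]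

variable {S}

/-- A morphism factors through the last morphism of a conflation iff it kills the extension. -/
lemma exists_comp_last_iff {Y A : C} {δ : S.E.Ext Y A} {W : NComplex n A Y} (hW : W ∈ S.s δ)
    {L : C} (g : L ⟶ Y) : (∃ t : L ⟶ W.cx.X n, t ≫ W.last = g) ↔ S.E.pull g δ = 0 := by
  constructor
  · rintro ⟨t, rfl⟩
    rw [pull_comp, (S.isNExangle δ W hW).pull_last, map_zero]
  · exact (S.isNExangle δ W hW).exact_hom_to_right g

/-- Exactness of `C(T, Y) → E(T, A) → E(T, W_1)` for a conflation from `A` to `Y`. -/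
lemma exists_pull_eq {Y A : C} {δ : S.E.Ext Y A} {W : NComplex n A Y} (hW : W ∈ S.s δ)
    {T : C} (m : S.E.Ext T A) (hm : S.E.push W.first m = 0) : ∃ g : T ⟶ Y, S.E.pull g δ = m := by
  -- This `ρ` restricts to `m` on `T` and to `δ` on `Y`. The cone of a good lift along `Y ⟶ T ⊞ Y`
  -- realizes the pushout of `ρ` along `W.first`, which is zero, so `biprod.inl` lifts to the cone.
  let ρ : S.E.Ext (T ⊞ Y) A := S.E.pull biprod.fst m + S.E.pull biprod.snd δ
  have hρ₁ : S.E.pull biprod.inl ρ = m := by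
    simp only [ρ, map_add]
    rw [← pull_comp, ← pull_comp, biprod.inl_fst, biprod.inl_snd, pull_id, pull_zero, add_zero]
  have hρ₂ : S.E.pull biprod.inr ρ = δ := by
    simp only [ρ, map_add]
    rw [← pull_comp, ← pull_comp, biprod.inr_fst, biprod.inr_snd, pull_id, pull_zero, zero_add]
  have hρ : S.E.push W.first ρ = 0 := by
    simp only [ρ, map_add]
    rw [push_pull, push_pull, hm, (S.isNExangle δ W hW).push_first, map_zero, map_zero, add_zero]
  obtain ⟨V, hV⟩ := S.nonempty ρ
  obtain ⟨f, hf, M, hM, φ, -, -, -, hlast⟩ :=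
    S.good_lift ρ biprod.inr W V (by rw [hρ₂]; exact hW) hV
  obtain ⟨t, ht⟩ := (exists_comp_last_iff hM (biprod.inl : T ⟶ T ⊞ Y)).2 (by rw [hρ, map_zero])
  -- The lift writes `biprod.inl` as a map through `Y` plus a map through `V.last`. Pulling `ρ` back
  -- kills the second summand, and the first gives the required `g`.
  have key : (biprod.inl : T ⟶ T ⊞ Y) =
      (t ≫ φ n ≫ biprod.fst ≫ W.right.hom) ≫ biprod.inr +
        (t ≫ φ n ≫ biprod.snd) ≫ V.last := by
    rw [← ht, hlast, biprod.desc_eq, hf.2]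
    simp
  refine ⟨t ≫ φ n ≫ biprod.fst ≫ W.right.hom, ?_⟩
  rw [← hρ₁, key, pull_add, pull_comp _ (_ ≫ _) biprod.inr, hρ₂, pull_comp _ (_ ≫ _) V.last,
    (S.isNExangle ρ V hV).pull_last, map_zero, add_zero]

/-- If the composite `Q ⟶ X ⟶ X₁ ⟶ Q` in the costable category is the identity and `X ⟶ X₁` is
radical, then `Q = 0`. -/
lemma id_eq_zero_of_inRadical {X X₁ : C} {α : X ⟶ X₁} (hα : InRadical α) {Q : S.Costable}
    (a : Q ⟶ S.toCostable.obj X) (x : S.toCostable.obj X₁ ⟶ Q)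
    (h : a ≫ S.toCostable.map α ≫ x = 𝟙 Q) : 𝟙 Q = 0 := by
  -- With `z` lifting `x ≫ a`, the isomorphism `𝟙 X - α ≫ z` becomes in the costable category one
  -- that is annihilated by `a` from the left, so `a = 0`.
  obtain ⟨z, hz⟩ := S.toCostable.map_surjective (x ≫ a)
  have := hα z
  have hiso : IsIso (S.toCostable.map (𝟙 X - α ≫ z)) := inferInstance
  rw [CategoryTheory.Functor.map_sub, CategoryTheory.Functor.map_id, CategoryTheory.Functor.map_comp, hz] at hiso
  have hzero : a ≫ (𝟙 _ - S.toCostable.map α ≫ x ≫ a) = 0 := by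
    rw [Preadditive.comp_sub, Category.comp_id]
    have : a ≫ S.toCostable.map α ≫ x ≫ a = a := by
      calc _ = (a ≫ S.toCostable.map α ≫ x) ≫ a := by simp only [Category.assoc]
        _ = a := by rw [h, Category.id_comp]
    rw [this, sub_self]
  have ha : a = 0 := by
    rw [← cancel_mono (𝟙 _ - S.toCostable.map α ≫ x ≫ a), hzero, zero_comp]
  rw [← h, ha, zero_comp]

/-! ### Consequences of Auslander–Reiten–Serre duality -/

namespace ARSDuality

variable {J : Type uk} [AddCommGroup J] [Module k J] (D : S.ARSDuality J)

/-- If `T` represents `τ⁻ X`, then `X ≅ τ T` in the costable category. -/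
lemma IsInverseTranslate.nonempty_iso {D : S.ARSDuality J} {X T : C}
    (hT : D.IsInverseTranslate X T) :
    Nonempty (S.toCostable.obj X ≅ D.τ.functor.obj (S.toStable.obj T)) :=
  ⟨(D.τ.functor.mapIso hT.some ≪≫ D.τ.counitIso.app _).symm⟩

lemma Φ_comp_pull {A A' B : C} (x : A ⟶ A') (φ : S.E.Ext A B →ₗ[k] J) :
    D.Φ A' B (φ ∘ₗ S.E.pull x) = D.Φ A B φ ≫ D.τ.functor.map (S.toStable.map x) := by
  have h := D.naturality x (𝟙 B) φ
  have h₁ : S.E.push (𝟙 B) = (LinearMap.id : S.E.Ext A' B →ₗ[k] _) :=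
    LinearMap.ext fun δ => S.push_id δ
  rwa [h₁, LinearMap.comp_id, CategoryTheory.Functor.map_id, Category.id_comp] at h

lemma Φ_comp_push {A B B' : C} (y : B' ⟶ B) (φ : S.E.Ext A B →ₗ[k] J) :
    D.Φ A B' (φ ∘ₗ S.E.push y) = S.toCostable.map y ≫ D.Φ A B φ := by
  have h := D.naturality (𝟙 A) y φ
  have h₁ : S.E.pull (𝟙 A) = (LinearMap.id : S.E.Ext A B →ₗ[k] _) :=
    LinearMap.ext fun δ => S.pull_id δ
  rwa [h₁, LinearMap.id_comp, CategoryTheory.Functor.map_id, CategoryTheory.Functor.map_id,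
    Category.comp_id] at h

variable {D} {X T : C}

/-- Fullness of `τ` and of the projection to the stable category. Through `Φ_comp_pull`, it makes
every functional on `E(L, X)` a pullback `h^*` followed by the one functional `(D.Φ T X).symm
e.hom`. -/
lemma exists_Φ_eq (e : S.toCostable.obj X ≅ D.τ.functor.obj (S.toStable.obj T))
    {L : C} (φ : S.toCostable.obj X ⟶ D.τ.functor.obj (S.toStable.obj L)) :
    ∃ h : T ⟶ L, φ = e.hom ≫ D.τ.functor.map (S.toStable.map h) := by
  obtain ⟨h', hh'⟩ := D.τ.functor.map_surjective (e.inv ≫ φ)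
  obtain ⟨h, rfl⟩ := S.toStable.map_surjective h'
  exact ⟨h, by rw [hh', e.hom_inv_id_assoc]⟩

/-- An extension by `X` killed by pulling back along all morphisms from `T = τ⁻ X` vanishes. -/
lemma eq_zero_of_pull (e : S.toCostable.obj X ≅ D.τ.functor.obj (S.toStable.obj T))
    (hJ : IsInjectiveCogenerator k J) {L : C} {m : S.E.Ext L X}
    (hm : ∀ h : T ⟶ L, S.E.pull h m = 0) : m = 0 := by
  by_contra hne
  obtain ⟨φ, hφ⟩ := hJ.exists_apply_ne_zero hne
  obtain ⟨h, hh⟩ := exists_Φ_eq e (D.Φ L X φ)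
  have : φ = (D.Φ T X).symm e.hom ∘ₗ S.E.pull h := by
    apply (D.Φ L X).injective
    rw [Φ_comp_pull, LinearEquiv.apply_symm_apply, hh]
  apply hφ
  rw [this, LinearMap.comp_apply, hm h, map_zero]

/-- An extension of `T = τ⁻ X` killed by pushing out along all morphisms to `X` vanishes. -/
lemma eq_zero_of_push (e : S.toCostable.obj X ≅ D.τ.functor.obj (S.toStable.obj T))
    (hJ : IsInjectiveCogenerator k J) {A : C} {m : S.E.Ext T A}
    (hm : ∀ a : A ⟶ X, S.E.push a m = 0) : m = 0 := by
  by_contra hne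
  obtain ⟨φ, hφ⟩ := hJ.exists_apply_ne_zero hne
  obtain ⟨a, ha⟩ := S.toCostable.map_surjective (D.Φ T A φ ≫ e.inv)
  have : φ = (D.Φ T X).symm e.hom ∘ₗ S.E.push a := by
    apply (D.Φ T A).injective
    rw [Φ_comp_push, LinearEquiv.apply_symm_apply, ha, Category.assoc, e.inv_hom_id,
      Category.comp_id]
  apply hφ
  rw [this, LinearMap.comp_apply, hm a, map_zero]

/-- The last morphism of a conflation starting in `add X` is right `τ⁻ X`-determined. -/
lemma rightDetermined_last (e : S.toCostable.obj X ≅ D.τ.functor.obj (S.toStable.obj T))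
    (hJ : IsInjectiveCogenerator k J) {X₀ Y : C} (hX₀ : InAdd X X₀)
    {δ : S.E.Ext Y X₀} {W : NComplex n X₀ Y} (hW : W ∈ S.s δ) : RightDetermined T W.last := by
  classical
  obtain ⟨r, ⟨ρ⟩⟩ := hX₀
  intro L g hg
  rw [exists_comp_last_iff hW]
  have hpush : ∀ a : X₀ ⟶ X, S.E.push a (S.E.pull g δ) = 0 := fun a =>
    eq_zero_of_pull e hJ fun h => by
      rw [← push_pull, ← pull_comp, (exists_comp_last_iff hW _).1 (hg h), map_zero]
  -- The identity of `X₀` is a sum of maps factoring through `X`, and each of these kills `g^*δ` by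
  -- `hpush`.
  rw [← S.push_id (S.E.pull g δ), ← ρ.retract,
    ← Category.comp_id ρ.i, ← biproduct.total, Preadditive.comp_sum, Preadditive.sum_comp,
    push_sum]
  refine Finset.sum_eq_zero fun j _ => ?_
  rw [← Category.assoc, Category.assoc _ _ ρ.r, push_comp, hpush, map_zero]

/-- A deflation which is right `τ⁻ X`-determined is right equivalent to the last morphism of a
conflation starting in a finite direct sum of copies of `X`. -/
lemma exists_rightClass_eq (e : S.toCostable.obj X ≅ D.τ.functor.obj (S.toStable.obj T))
    [IsArtinianRing k] (hfin : S.ExtFinite)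
    (hJ : IsInjectiveCogenerator k J) {A Y : C} {δ : S.E.Ext Y A} {W : NComplex n A Y}
    (hW : W ∈ S.s δ) (hdet : RightDetermined T W.last) :
    ∃ (m : ℕ) (δ' : S.E.Ext Y (⨁ fun _ : Fin m => X)) (W' : NComplex n _ Y),
      W' ∈ S.s δ' ∧ rightClass W'.last = rightClass W.last := by
  classical
  have := hfin Y X
  -- `N` consists of all pushouts of `δ` to `X`. Finitely many maps `a j` yield generators of `N`,
  -- and together they form `b`; pushing out along `b` thus retains all of `N`.
  let N : Submodule k (S.E.Ext Y X) :=
    { carrier := Set.range fun a : A ⟶ X => S.E.push a δ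
      zero_mem' := ⟨0, S.push_zero δ⟩
      add_mem' := by
        rintro _ _ ⟨a, rfl⟩ ⟨b, rfl⟩
        exact ⟨a + b, S.push_add a b δ⟩
      smul_mem' := by
        rintro c _ ⟨a, rfl⟩
        exact ⟨c • a, S.push_smul c a δ⟩ }
  obtain ⟨m, s, hs⟩ := Submodule.fg_iff_exists_fin_generating_family.1
    (IsNoetherian.noetherian N)
  have hsN : ∀ j, s j ∈ N := fun j => hs ▸ Submodule.subset_span ⟨j, rfl⟩
  choose a ha using hsN
  let b : A ⟶ ⨁ fun _ : Fin m => X := biproduct.lift a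
  obtain ⟨W', hW'⟩ := S.nonempty (S.E.push b δ)
  have iff : ∀ {L : C} (g : L ⟶ Y), S.E.pull g (S.E.push b δ) = 0 ↔ S.E.pull g δ = 0 := by
    intro L g
    refine ⟨fun h => ?_, fun h => by rw [← push_pull, h, map_zero]⟩
    have hsj : ∀ j, S.E.pull g (s j) = 0 := fun j => by
      have hb : b ≫ biproduct.π _ j = a j := biproduct.lift_π _ _
      have : s j = S.E.push (biproduct.π _ j) (S.E.push b δ) := by
        rw [← push_comp, hb]
        exact (ha j).symm
      rw [this, ← push_pull, h, map_zero]
    have hN : N ≤ LinearMap.ker (S.E.pull g) := by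
      rw [← hs, Submodule.span_le]
      rintro _ ⟨j, rfl⟩
      exact hsj j
    rw [← exists_comp_last_iff hW]
    -- Determination reduces the claim to an extension of `T`, whose vanishing is tested by pushouts
    -- to `X`; these vanish because `g^*` kills `N`.
    refine hdet g fun h => ?_
    rw [exists_comp_last_iff hW]
    refine eq_zero_of_push e hJ fun c => ?_
    have hc : S.E.pull g (S.E.push c δ) = 0 := hN ⟨c, rfl⟩
    rw [push_pull, pull_comp, hc, map_zero]
  refine ⟨m, S.E.push b δ, W', hW', Quotient.sound ⟨?_, ?_⟩⟩
  · exact (exists_comp_last_iff hW _).2 ((iff _).1 (S.isNExangle _ W' hW').pull_last)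
  · exact (exists_comp_last_iff hW' _).2 ((iff _).2 (S.isNExangle _ W hW).pull_last)

/-- A non-projective local direct summand of `τ⁻ X` is a direct summand of every object
determining the last morphism of a conflation whose first morphism is radical. -/
lemma nonempty_retract (e : S.toCostable.obj X ≅ D.τ.functor.obj (S.toStable.obj T))
    [IsArtinianRing k] (hfin : S.ExtFinite)
    (hJ : IsInjectiveCogenerator k J) {Y : C} {δ : S.E.Ext Y X} {W : NComplex n X Y}
    (hW : W ∈ S.s δ) (hrad : InRadical W.first) {B : C} (hdet : RightDetermined B W.last)
    {T' : C} [IsLocalRing (End T')] (r : Retract T' T) (hT' : ¬ S.IsProjective T') :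
    Nonempty (Retract T' B) := by
  classical
  by_contra hB
  have hnon : ∀ (b : T' ⟶ B) (h : B ⟶ T'), ¬ IsUnit (M := End T') (b ≫ h) := by
    intro b h hu
    have := (CategoryTheory.isUnit_iff_isIso _).1 hu
    exact hB ⟨⟨b, h ≫ inv (show T' ⟶ T' from b ≫ h), by
      rw [← Category.assoc]; exact IsIso.hom_inv_id (b ≫ h)⟩⟩
  have := hfin T' X
  -- `none` indexes the pushout along `W.first`, `some h` the pullback along `h`.
  let N : Option (B ⟶ T') → Type w
    | none => S.E.Ext T' (W.cx.X 1)
    | some _ => S.E.Ext B X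
  let _ : ∀ i, AddCommGroup (N i) := fun i => match i with
    | none => inferInstanceAs (AddCommGroup (S.E.Ext T' (W.cx.X 1)))
    | some _ => inferInstanceAs (AddCommGroup (S.E.Ext B X))
  let _ : ∀ i, Module k (N i) := fun i => match i with
    | none => inferInstanceAs (Module k (S.E.Ext T' (W.cx.X 1)))
    | some _ => inferInstanceAs (Module k (S.E.Ext B X))
  let g : ∀ i, S.E.Ext T' X →ₗ[k] N i := fun i => match i with
    | none => S.E.push W.first
    | some h => S.E.pull h
  have hg : ∀ m, (∀ i, g i m = 0) → m = 0 := by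
    intro m hm
    -- The kernel of the pushout consists of the `c^*δ`; if all pullbacks to `B` vanish,
    -- determination makes `c` factor through `W.last`.
    obtain ⟨c, rfl⟩ := exists_pull_eq hW m (hm none)
    rw [← exists_comp_last_iff hW]
    refine hdet c fun h => ?_
    rw [exists_comp_last_iff hW, pull_comp]
    exact hm (some h)
  -- The nonunit condition records what is needed of a sum of maps through `B`, and survives
  -- addition because `End T'` is local.
  let P : (S.E.Ext T' X →ₗ[k] J) → Prop := fun φ =>
    ∃ (x : S.toCostable.obj (W.cx.X 1) ⟶ D.τ.functor.obj (S.toStable.obj T')) (t : T ⟶ T'),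
      (∀ i : T' ⟶ T, ¬ IsUnit (M := End T') (i ≫ t)) ∧
      D.Φ T' X φ = S.toCostable.map W.first ≫ x + e.hom ≫ D.τ.functor.map (S.toStable.map t)
  have hτ := D.additive
  have hPzero : P 0 := by
    refine ⟨0, 0, fun i => ?_, by simp⟩
    rw [comp_zero]
    exact zero_mem_nonunits.2 zero_ne_one
  have hPadd : ∀ φ ψ, P φ → P ψ → P (φ + ψ) := by
    rintro φ ψ ⟨x, t, ht, h⟩ ⟨x', t', ht', h'⟩
    refine ⟨x + x', t + t', fun i => ?_, ?_⟩
    · rw [Preadditive.comp_add]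
      exact IsLocalRing.nonunits_add (ht i) (ht' i)
    · rw [map_add, h, h', CategoryTheory.Functor.map_add, CategoryTheory.Functor.map_add, Preadditive.comp_add,
        Preadditive.comp_add]
      abel
  have hPg : ∀ i (ψ : N i →ₗ[k] J), P (ψ ∘ₗ g i) := by
    rintro (_ | h) ψ
    · refine ⟨D.Φ T' (W.cx.X 1) ψ, 0, fun i => ?_, ?_⟩
      · rw [comp_zero]
        exact zero_mem_nonunits.2 zero_ne_one
      · rw [CategoryTheory.Functor.map_zero, CategoryTheory.Functor.map_zero, comp_zero, add_zero]
        exact D.Φ_comp_push W.first ψ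
    · obtain ⟨t, ht⟩ := exists_Φ_eq e (D.Φ B X ψ)
      refine ⟨0, t ≫ h, fun i => ?_, ?_⟩
      · rw [← Category.assoc]
        exact hnon _ _
      · rw [comp_zero, zero_add, CategoryTheory.Functor.map_comp, CategoryTheory.Functor.map_comp, ← Category.assoc, ← ht]
        exact D.Φ_comp_pull h ψ
  obtain ⟨s, ψ, hψ⟩ := exists_eq_sum_comp hJ.1 g hg
    ((D.Φ T' X).symm (e.hom ≫ D.τ.functor.map (S.toStable.map r.r)))
  have hP : P (∑ i ∈ s, ψ i ∘ₗ g i) :=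
    Finset.sum_induction _ P hPadd hPzero fun i _ => hPg i (ψ i)
  rw [← hψ] at hP
  obtain ⟨x, t, ht, h⟩ := hP
  rw [LinearEquiv.apply_symm_apply, ← sub_eq_iff_eq_add, ← Preadditive.comp_sub,
    ← CategoryTheory.Functor.map_sub, ← CategoryTheory.Functor.map_sub] at h
  -- This endomorphism is the identity minus the nonunit `r.i ≫ t`. Its inverse exhibits `τT'` as a
  -- retract through `W.first` in the costable category.
  have hunit : IsIso (r.i ≫ (r.r - t)) := by
    rw [← CategoryTheory.isUnit_iff_isIso]
    by_contra hn
    refine IsLocalRing.nonunits_add hn (ht r.i) ?_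
    have : r.i ≫ (r.r - t) + r.i ≫ t = 𝟙 T' := by
      rw [← Preadditive.comp_add, sub_add_cancel, r.retract]
    exact this ▸ (isUnit_one : IsUnit (1 : End T'))
  have hid := id_eq_zero_of_inRadical hrad
    (D.τ.functor.map (S.toStable.map (inv (r.i ≫ (r.r - t)) ≫ r.i)) ≫ e.inv) x (by
      rw [← h, Category.assoc, e.inv_hom_id_assoc, ← CategoryTheory.Functor.map_comp, ← CategoryTheory.Functor.map_comp,
        Category.assoc, IsIso.inv_hom_id, CategoryTheory.Functor.map_id, CategoryTheory.Functor.map_id])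
  have hid' : S.toStable.map (𝟙 T') = S.toStable.map 0 := by
    apply D.τ.functor.map_injective
    rw [CategoryTheory.Functor.map_id, CategoryTheory.Functor.map_id, hid, S.toStable.map_zero, D.τ.functor.map_zero]
  have := (Quotient.functor_map_eq_iff S.projRel _ _).1 hid'
  exact hT' (by simpa [projRel, IsProjective] using this)

end ARSDuality

end NExangulated

end NExang

theorem lemma4p9 {k : Type*} [CommRing k] [IsArtinianRing k]
    {C : Type*} [Category C] [Preadditive C] [Linear k C] [HasFiniteBiproducts C]
    {n : ℕ} (hn : 1 ≤ n) (S : NExang.NExangulated k C n)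
    (hKS : NExang.KrullSchmidt C) (hfin : S.ExtFinite) (hWIC : S.WICondition)
    {J : Type _} [AddCommGroup J] [Module k J] (hJ : NExang.IsMinimalInjectiveCogenerator k J)
    (D : S.ARSDuality J) (X Y T : C) (hT : D.IsInverseTranslate X T) :
    (∀ (δ : S.E.Ext Y X) (W : NExang.NComplex n X Y), W ∈ S.s δ →
      NExang.RightDetermined T W.last ∧
      (NExang.InRadical W.first → S.NoProjectiveSummand T →
        ∀ B : C, NExang.RightDetermined B W.last ↔ NExang.InAdd B T)) ∧
    S.kernelEndClasses X Y = S.deflationClasses Y ∩ NExang.determinedClasses T Y := by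
  have hcog := hJ.1
  obtain ⟨e⟩ := hT.nonempty_iso
  have hX : NExang.InAdd X X := ⟨1, ⟨⟨biproduct.lift fun _ => 𝟙 X, biproduct.π _ 0, by simp⟩⟩⟩
  refine ⟨fun δ W hW => ?_, ?_⟩
  · have hdet : NExang.RightDetermined T W.last :=
      NExang.NExangulated.ARSDuality.rightDetermined_last e hcog hX hW
    refine ⟨hdet, fun hrad hproj B => ⟨fun hB => ?_, hdet.of_inAdd⟩⟩
    obtain ⟨m, Y', hloc, ⟨i⟩⟩ := hKS T
    refine NExang.inAdd_of_retracts i fun j => ?_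
    have := hloc j
    let r : Retract (Y' j) T := ⟨biproduct.ι Y' j ≫ i.inv, i.hom ≫ biproduct.π Y' j, by simp⟩
    refine NExang.NExangulated.ARSDuality.nonempty_retract e hfin hcog hW hrad hB r fun hP => ?_
    -- A projective summand would be zero, but a local endomorphism ring is nontrivial.
    exact one_ne_zero (α := End (Y' j)) ((hproj _ ⟨r⟩ hP).eq_of_src _ _)
  · ext c
    constructor
    · rintro ⟨X₀, δ, W, hW, hX₀, rfl⟩
      exact ⟨⟨_, W.last, ⟨X₀, δ, W, Iso.refl _, hW, Category.id_comp _⟩, rfl⟩,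
        _, W.last, NExang.NExangulated.ARSDuality.rightDetermined_last e hcog hX₀ hW, rfl⟩
    · rintro ⟨⟨Z, f, ⟨A, δ, W, φ, hW, rfl⟩, rfl⟩, Z', f', hf', hc⟩
      have hcl : NExang.rightClass (φ.hom ≫ W.last) = NExang.rightClass W.last :=
        Quotient.sound ⟨⟨φ.hom, rfl⟩, φ.inv, φ.inv_hom_id_assoc _⟩
      obtain ⟨m, δ', W', hW', h⟩ := NExang.NExangulated.ARSDuality.exists_rightClass_eq e hfin
        hcog hW (hf'.of_rightEquiv (hc.trans hcl))
      exact ⟨_, δ', W', hW', NExang.inAdd_biproduct X m, h.trans hcl.symm⟩
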